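/- Let $f,g$ be real functions that are analytic in a neighborhood of $0\in\mathbb R$, with $g(0)=0$ and $g'(0)=1$ (so that $xg(x)>0$ for small $x\neq 0$). Consider the equation $$(E)\qquad \ddot x+f(x)\dot x^2+g(x)=0,$$ i.e. the planar system $\dot x=y,\ \dot y=-g(x)-f(x)y^2$. The origin is called an isochronous center of $(E)$ if it is a stationary point with a neighborhood $U$ in the plane such that the orbit of every point of $U$ other than the origin is a closed orbit contained in $U$, and all these orbits have the same minimal period. Put $$F(x)=\int_0^x f(s)\,ds,\qquad \phi(x)=\int_0^x e^{F(s)}\,ds,$$ and, for $x$ near $0$, define $X=X(x)$ by $\tfrac12X^2=\int_0^x g(s)e^{2F(s)}\,ds$, $X$ having the sign of $x$. A function $h$ of class $C^1$ near $0$ is called the Urabe function of $(E)$ if, near $0$, $1+h>0$ and $$g(x)e^{F(x)}=\frac{X}{1+h(X)},\qquad \phi(x)=X+\int_0^X h(t)\,dt$$ (the case $h\equiv0$ is allowed). All identities below are meant in a neighborhood of $0$. 1. $(E)$ has an isochronous center at $0$ if and only if there is an odd Urabe function $h$ of $(E)$ with $$g'(x)+f(x)g(x)=\frac{1+h(X)-h'(X)X}{(1+h(X))^3}.\qquad(*)$$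 Moreover, every odd function $h$ of class $C^1$ near $0$ that satisfies $(*)$ is the Urabe function of $(E)$; so the existence of such an $h$ is already equivalent to isochronicity. 2. If $f$ and $g$ are odd and $h$ is the Urabe function of $(E)$ (in particular in the isochronous case), then $$g'(x)+f(x)g(x)= 1\ \text{ near } 0\quad\Longleftrightarrow\quad h\equiv 0\ \text{ near } 0.$$ -/

import Mathlib

open Filter Topology

noncomputable section

/-- `t ↦ (x t, y t)` is a solution, defined for all times, of the planar system
`x' = y`, `y' = -g(x) - f(x) y ^ 2` equivalent to `(E) : x'' + f(x) x' ^ 2 + g(x) = 0`. -/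
def IsSolution (f g : ℝ → ℝ) (x y : ℝ → ℝ) : Prop :=
  ∀ t : ℝ, HasDerivAt x (y t) t ∧ HasDerivAt y (-g (x t) - f (x t) * y t ^ 2) t

/-- `T` is the minimal (positive) period of the curve `γ`. -/
def IsMinimalPeriod (γ : ℝ → ℝ × ℝ) (T : ℝ) : Prop :=
  IsLeast {S : ℝ | 0 < S ∧ ∀ t : ℝ, γ (t + S) = γ t} T

/-- The origin is an isochronous center of `(E)`: it is a stationary point, and it has a
neighborhood `U` in the phase plane such that the orbit of every point of `U` other than the
origin is a closed orbit contained in `U`, all these orbits having the same minimal period. -/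
def IsIsochronousCenter (f g : ℝ → ℝ) : Prop :=
  g 0 = 0 ∧ ∃ T : ℝ, ∃ U ∈ 𝓝 (0 : ℝ × ℝ), ∀ p ∈ U, p ≠ 0 →
    ∃ x y : ℝ → ℝ, IsSolution f g x y ∧ (x 0, y 0) = p ∧ (∀ t : ℝ, (x t, y t) ∈ U) ∧
      IsMinimalPeriod (fun t => (x t, y t)) T

/-- `F(x) = ∫_0^x f(s) ds`. -/
def primF (f : ℝ → ℝ) (x : ℝ) : ℝ := ∫ s in (0 : ℝ)..x, f s

/-- `φ(x) = ∫_0^x e^{F(s)} ds`. -/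
def phi (f : ℝ → ℝ) (x : ℝ) : ℝ := ∫ s in (0 : ℝ)..x, Real.exp (primF f s)

/-- The variable `X = X(x)` determined by `X ^ 2 / 2 = ∫_0^x g(s) e^{2F(s)} ds` and by the
requirement that `X` has the sign of `x` (which is the sign of `φ(x)`). -/
def bigX (f g : ℝ → ℝ) (x : ℝ) : ℝ :=
  Real.sign x * √(2 * ∫ s in (0 : ℝ)..x, g s * Real.exp (2 * primF f s))

/-- `h` is of class `C¹` near `0` and odd near `0`. -/
def IsOddC1 (h : ℝ → ℝ) : Prop :=
  ContDiffAt ℝ 1 h 0 ∧ ∀ᶠ X in 𝓝 (0 : ℝ), h (-X) = -h X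

/-- `h` is the Urabe function of `(E)` (determined near `0`, trivial case `h ≡ 0` allowed,
oddness not included): it is of class `C¹` near `0`, and near `x = 0`
`g(x) e^{F(x)} = X / (1 + h(X))` and `φ(x) = X + ∫_0^X h(t) dt`. -/
structure IsUrabeFunction (f g h : ℝ → ℝ) : Prop where
  contDiffAt : ContDiffAt ℝ 1 h 0
  one_add_pos : ∀ᶠ X in 𝓝 (0 : ℝ), 0 < 1 + h X
  force_eq : ∀ᶠ x in 𝓝 (0 : ℝ),
    g x * Real.exp (primF f x) = bigX f g x / (1 + h (bigX f g x))
  phi_eq : ∀ᶠ x in 𝓝 (0 : ℝ), phi f x = bigX f g x + ∫ t in (0 : ℝ)..(bigX f g x), h t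

/-- The equation `g' + f g = (1 + h(X) - h'(X) X) / (1 + h(X)) ^ 3`, with `X = X(x)`, for all
`x` in a neighborhood of `0`. -/
def UrabeEquation (f g h : ℝ → ℝ) : Prop :=
  ∀ᶠ x in 𝓝 (0 : ℝ),
    deriv g x + f x * g x =
      (1 + h (bigX f g x) - deriv h (bigX f g x) * bigX f g x) / (1 + h (bigX f g x)) ^ 3

end

/-! The coordinates `X` and `e^F y` straighten the orbits: differentiating `X² / 2` gives `X X' = g
e^{2F}`, so `X² + (e^F y)²` is conserved. Because `g 0 = 0` and `deriv g 0 = 1`, `X` is an analytic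
local coordinate, and hence `φ' = X' (1 + k(X))` for some analytic `k`, which is the Urabe function,
unique as a germ. On the circle `X = r sin θ`, `e^F y = r cos θ`, the motion is `θ' = 1 / (1 + k(r
sin θ))` (`exists_orbit`), so the minimal period is `∫_0^{2π} (1 + k(r sin s)) ds`.

Only the even part of `k` contributes to this integral. If it vanishes, every period is `2π`;
conversely, if the period does not depend on `r`, analyticity forces the even part to be constant
(`AnalyticAt.eventually_eq_of_integral_comp_sin`), and `k 0 = 0` makes it zero.

Equation (*) is the derivative of the force identity; `UrabeEquation.isUrabeFunction` integrates it
back when `h 0 = 0`. The last part combines this with uniqueness of the germ. -/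

/-! ### Analytic primitives and integrals -/

/-- An analytic function has an analytic primitive. -/
theorem AnalyticAt.exists_analyticAt_primitive {f : ℝ → ℝ} (hf : AnalyticAt ℝ f 0) :
    ∃ G : ℝ → ℝ, AnalyticAt ℝ G 0 ∧ ∀ᶠ z in 𝓝 0, deriv G z = f z := by
  obtain ⟨p, hp⟩ := hf
  -- At `n = 0` division by zero makes the coefficient `0`, whatever the truncated index `n - 1`
  -- gives.
  set c : ℕ → ℝ := fun n => p.coeff (n - 1) / n with hc
  set q := FormalMultilinearSeries.ofScalars ℝ c with hq
  have hcoeff (n : ℕ) : q.coeff n = c n := by simp [hq]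
  have hrad : 0 < q.radius := by
    obtain ⟨r, hr0, hr⟩ := ENNReal.lt_iff_exists_nnreal_btwn.1 hp.radius_pos
    obtain ⟨C, hC0, hC⟩ := p.norm_mul_pow_le_of_lt_radius hr
    refine lt_of_lt_of_le hr0 (q.le_radius_of_bound (C * r) fun n => ?_)
    rw [FormalMultilinearSeries.norm_apply_eq_norm_coef, hcoeff]
    rcases n with _ | n
    · simp [hc]; positivity
    · have h1 := hC n
      rw [FormalMultilinearSeries.norm_apply_eq_norm_coef] at h1
      have h2 : ‖c (n + 1)‖ ≤ ‖p.coeff n‖ := by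
        simp only [hc, Nat.add_sub_cancel, norm_div]
        refine div_le_self (norm_nonneg _) ?_
        rw [Real.norm_of_nonneg (by positivity)]
        push_cast
        linarith [Nat.cast_nonneg (α := ℝ) n]
      calc ‖c (n + 1)‖ * (r : ℝ) ^ (n + 1) ≤ ‖p.coeff n‖ * (r : ℝ) ^ (n + 1) := by gcongr
        _ = (‖p.coeff n‖ * (r : ℝ) ^ n) * r := by ring
        _ ≤ C * r := by gcongr
  have hG := q.hasFPowerSeriesOnBall hrad
  refine ⟨q.sum, hG.analyticAt, ?_⟩
  have hd := hasFPowerSeriesAt_iff.1 hG.fderiv.hasFPowerSeriesAt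
  filter_upwards [hd, hasFPowerSeriesAt_iff.1 hp] with z h1 h2
  have h3 := h1.mapL (ContinuousLinearMap.apply ℝ ℝ (1 : ℝ))
  rw [zero_add] at h3 h2
  rw [← fderiv_apply_one_eq_deriv]
  refine h3.unique ?_
  convert! h2 using 2 with n
  simp [hcoeff, FormalMultilinearSeries.derivSeries_coeff_one, hc]
  field_simp
  exact Or.inl trivial

theorem eventuallyEq_of_hasDerivAt {u v w : ℝ → ℝ} (hu : ∀ᶠ x in 𝓝 0, HasDerivAt u (w x) x)
    (hv : ∀ᶠ x in 𝓝 0, HasDerivAt v (w x) x) (h0 : u 0 = v 0) : u =ᶠ[𝓝 0] v := by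
  obtain ⟨ε, hε, h⟩ := Metric.eventually_nhds_iff_ball.1 (hu.and hv)
  refine Filter.eventuallyEq_of_mem (Metric.ball_mem_nhds 0 hε) ?_
  exact Metric.isOpen_ball.eqOn_of_deriv_eq (convex_ball 0 ε).isPreconnected
    (fun x hx => (h x hx).1.differentiableAt.differentiableWithinAt)
    (fun x hx => (h x hx).2.differentiableAt.differentiableWithinAt)
    (fun x hx => (h x hx).1.deriv.trans (h x hx).2.deriv.symm) (Metric.mem_ball_self hε) h0

theorem eventually_hasDerivAt_integral {u : ℝ → ℝ} (hu : ∀ᶠ x in 𝓝 0, ContinuousAt u x) :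
    ∀ᶠ x in 𝓝 0, HasDerivAt (fun x => ∫ s in (0 : ℝ)..x, u s) (u x) x := by
  obtain ⟨ε, hε, h⟩ := Metric.eventually_nhds_iff_ball.1 hu
  have hc : ContinuousOn u (Metric.ball 0 ε) := fun x hx => (h x hx).continuousWithinAt
  filter_upwards [Metric.ball_mem_nhds 0 hε] with x hx
  refine intervalIntegral.integral_hasDerivAt_right ?_
    (hc.stronglyMeasurableAtFilter Metric.isOpen_ball x hx) (h x hx)
  refine (hc.mono ?_).intervalIntegrable
  rw [← segment_eq_uIcc]
  exact (convex_ball 0 ε).segment_subset (Metric.mem_ball_self hε) hx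

theorem AnalyticAt.eventually_hasDerivAt_integral {u : ℝ → ℝ} (hu : AnalyticAt ℝ u 0) :
    ∀ᶠ x in 𝓝 0, HasDerivAt (fun x => ∫ s in (0 : ℝ)..x, u s) (u x) x :=
  _root_.eventually_hasDerivAt_integral (hu.eventually_analyticAt.mono fun _ h => h.continuousAt)

theorem AnalyticAt.intervalIntegral {u : ℝ → ℝ} (hu : AnalyticAt ℝ u 0) :
    AnalyticAt ℝ (fun x => ∫ s in (0 : ℝ)..x, u s) 0 := by
  obtain ⟨G, hG, hGu⟩ := hu.exists_analyticAt_primitive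
  have hG' : ∀ᶠ x in 𝓝 0, HasDerivAt (fun x => G x - G 0) (u x) x := by
    filter_upwards [hG.eventually_analyticAt, hGu] with x hx hx'
    rw [← hx']
    exact hx.differentiableAt.hasDerivAt.sub_const _
  exact (hG.sub analyticAt_const).congr
    (eventuallyEq_of_hasDerivAt hG' hu.eventually_hasDerivAt_integral (by simp))

theorem AnalyticAt.dslope {u : ℝ → ℝ} {a : ℝ} (hu : AnalyticAt ℝ u a) :
    AnalyticAt ℝ (dslope u a) a := by
  obtain ⟨p, hp⟩ := hu
  exact hp.has_fpower_series_dslope_fslope.analyticAt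

theorem AnalyticAt.eventually_hasDerivAt {u : ℝ → ℝ} {a : ℝ} (hu : AnalyticAt ℝ u a) :
    ∀ᶠ x in 𝓝 a, HasDerivAt u (deriv u x) x :=
  hu.eventually_analyticAt.mono fun _ h => h.differentiableAt.hasDerivAt

/-! ### The coordinate `X` and its local inverse -/

theorem analyticAt_primF {f : ℝ → ℝ} (hf : AnalyticAt ℝ f 0) : AnalyticAt ℝ (primF f) 0 :=
  hf.intervalIntegral

theorem hasDerivAt_primF {f : ℝ → ℝ} (hf : AnalyticAt ℝ f 0) :
    ∀ᶠ x in 𝓝 0, HasDerivAt (primF f) (f x) x :=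
  hf.eventually_hasDerivAt_integral

@[simp] theorem primF_zero (f : ℝ → ℝ) : primF f 0 = 0 := by simp [primF]

@[simp] theorem phi_zero (f : ℝ → ℝ) : phi f 0 = 0 := by simp [phi]

@[simp] theorem bigX_zero (f g : ℝ → ℝ) : bigX f g 0 = 0 := by simp [bigX]

/-- A function with a double zero at `0` is the square of `x` times an analytic factor. -/
theorem exists_eq_sq_mul {J G : ℝ → ℝ} (hJ : AnalyticAt ℝ J 0) (hG : AnalyticAt ℝ G 0)
    (hJ0 : J 0 = 0) (hG0 : G 0 = 0) (hJG : ∀ᶠ x in 𝓝 0, HasDerivAt J (2 * G x) x) :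
    ∃ m : ℝ → ℝ, AnalyticAt ℝ m 0 ∧ m 0 = deriv G 0 ∧ ∀ x, J x = x ^ 2 * m x := by
  have h1 : ∀ x, J x = x * dslope J 0 x := fun x => by
    simpa [hJ0] using (sub_smul_dslope J 0 x).symm
  have h10 : dslope J 0 0 = 0 := by
    rw [dslope_same, hJG.self_of_nhds.deriv, hG0, mul_zero]
  have h2 : ∀ x, dslope J 0 x = x * dslope (dslope J 0) 0 x := fun x => by
    have := sub_smul_dslope (dslope J 0) 0 x
    rw [h10, sub_zero, sub_zero, smul_eq_mul] at this
    exact this.symm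
  have h3 : ∀ x, G x = x * dslope G 0 x := fun x => by
    simpa [hG0] using (sub_smul_dslope G 0 x).symm
  set m := dslope (dslope J 0) 0 with hm
  have hma : AnalyticAt ℝ m 0 := hJ.dslope.dslope
  have hJm : ∀ x, J x = x ^ 2 * m x := fun x => by rw [h1, h2]; ring
  refine ⟨m, hma, ?_, hJm⟩
  have hl : ContinuousAt (fun x => 2 * m x + x * deriv m x) 0 :=
    (continuousAt_const.mul hma.continuousAt).add (continuousAt_id.mul hma.deriv.continuousAt)
  have hr : ContinuousAt (fun x => 2 * dslope G 0 x) 0 :=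
    continuousAt_const.mul hG.dslope.continuousAt
  -- Differentiating `J = x² m` leaves a common factor `x`, cancelled off `0`; continuity then
  -- extends the identity to `0`, where it gives `m 0`.
  have he : ∀ᶠ x in 𝓝[≠] (0 : ℝ), 2 * m x + x * deriv m x = 2 * dslope G 0 x := by
    filter_upwards [hJG.filter_mono nhdsWithin_le_nhds,
      hma.eventually_hasDerivAt.filter_mono nhdsWithin_le_nhds, self_mem_nhdsWithin] with x h4 h5 h6
    have h7 := (((hasDerivAt_id x).pow 2).mul h5).unique
      (h4.congr_of_eventuallyEq (Eventually.of_forall fun y => by simp [hJm]))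
    rw [h3 x] at h7
    refine mul_left_cancel₀ (show x ≠ 0 from h6) ?_
    simp only [id, Pi.pow_apply] at h7
    push_cast at h7
    linear_combination h7
  have := ((hl.eventuallyEq_nhds_iff_eventuallyEq_nhdsNE hr).1 he).self_of_nhds
  simpa [dslope_same] using this

theorem analyticAt_exp_primF {f : ℝ → ℝ} (hf : AnalyticAt ℝ f 0) :
    AnalyticAt ℝ (fun x => Real.exp (primF f x)) 0 :=
  (analyticAt_primF hf).rexp

theorem analyticAt_mul_exp_primF {f g : ℝ → ℝ} (hf : AnalyticAt ℝ f 0) (hg : AnalyticAt ℝ g 0) :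
    AnalyticAt ℝ (fun x => g x * Real.exp (2 * primF f x)) 0 :=
  hg.mul ((analyticAt_const.mul (analyticAt_primF hf)).rexp)

/-- Since `sign(x) √(x²) = x`, the double zero of the integral absorbs the sign, leaving only the
root of a factor that is `1` at `0`. This is what makes `X` analytic despite its definition. -/
theorem exists_bigX_eq_mul_sqrt {f g : ℝ → ℝ} (hf : AnalyticAt ℝ f 0) (hg : AnalyticAt ℝ g 0)
    (hg0 : g 0 = 0) (hg1 : deriv g 0 = 1) :
    ∃ m : ℝ → ℝ, AnalyticAt ℝ m 0 ∧ m 0 = 1 ∧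
      (∀ x, 2 * (∫ s in (0 : ℝ)..x, g s * Real.exp (2 * primF f s)) = x ^ 2 * m x) ∧
      ∀ x, bigX f g x = x * √(m x) := by
  have hG := analyticAt_mul_exp_primF hf hg
  obtain ⟨m, hm, hm0, h⟩ := exists_eq_sq_mul (analyticAt_const.mul hG.intervalIntegral) hG
    (by simp) (by simp [hg0]) (hG.eventually_hasDerivAt_integral.mono fun x hx => hx.const_mul 2)
  replace h : ∀ x, 2 * (∫ s in (0 : ℝ)..x, g s * Real.exp (2 * primF f s)) = x ^ 2 * m x := h
  refine ⟨m, hm, ?_, h, fun x => ?_⟩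
  · have h1 := hg.differentiableAt.hasDerivAt.mul
      (((hasDerivAt_primF hf).self_of_nhds.const_mul 2).exp)
    rw [hm0]
    exact (show deriv (fun x => g x * Real.exp (2 * primF f x)) 0 = _ from h1.deriv).trans
      (by simp [hg0, hg1])
  · rw [bigX, h, Real.sqrt_mul (sq_nonneg x), Real.sqrt_sq_eq_abs, ← mul_assoc]
    congr 1
    rcases lt_trichotomy x 0 with hx | rfl | hx
    · simp [Real.sign_of_neg hx, abs_of_neg hx]
    · simp
    · simp [Real.sign_of_pos hx, abs_of_pos hx]

theorem analyticAt_bigX {f g : ℝ → ℝ} (hf : AnalyticAt ℝ f 0) (hg : AnalyticAt ℝ g 0)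
    (hg0 : g 0 = 0) (hg1 : deriv g 0 = 1) : AnalyticAt ℝ (bigX f g) 0 := by
  obtain ⟨m, hm, hm0, -, h⟩ := exists_bigX_eq_mul_sqrt hf hg hg0 hg1
  rw [show bigX f g = fun x => x * √(m x) from funext h]
  refine analyticAt_id.mul ?_
  exact ((hm.contDiffAt (n := ⊤)).sqrt (by simp [hm0])).analyticAt

theorem deriv_bigX_zero {f g : ℝ → ℝ} (hf : AnalyticAt ℝ f 0) (hg : AnalyticAt ℝ g 0)
    (hg0 : g 0 = 0) (hg1 : deriv g 0 = 1) : deriv (bigX f g) 0 = 1 := by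
  obtain ⟨m, hm, hm0, -, h⟩ := exists_bigX_eq_mul_sqrt hf hg hg0 hg1
  rw [show bigX f g = fun x => x * √(m x) from funext h]
  have h1 := (hasDerivAt_id (0 : ℝ)).mul
    (hm.differentiableAt.hasDerivAt.sqrt (by simp [hm0]))
  exact (show deriv (fun x => x * √(m x)) 0 = _ from h1.deriv).trans (by simp [hm0])

theorem bigX_mul_deriv_bigX {f g : ℝ → ℝ} (hf : AnalyticAt ℝ f 0) (hg : AnalyticAt ℝ g 0)
    (hg0 : g 0 = 0) (hg1 : deriv g 0 = 1) :
    ∀ᶠ x in 𝓝 0, bigX f g x * deriv (bigX f g) x = g x * Real.exp (primF f x) ^ 2 := by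
  obtain ⟨m, hm, hm0, hI, h⟩ := exists_bigX_eq_mul_sqrt hf hg hg0 hg1
  have hpos : ∀ᶠ x in 𝓝 0, 0 < m x := hm.continuousAt.eventually (lt_mem_nhds (by simp [hm0]))
  have hsq : ∀ᶠ x in 𝓝 0, bigX f g x ^ 2
      = 2 * (∫ s in (0 : ℝ)..x, g s * Real.exp (2 * primF f s)) :=
    hpos.mono fun x hx => by rw [hI, h, mul_pow, Real.sq_sqrt hx.le]
  filter_upwards [hsq.eventually_nhds, (analyticAt_bigX hf hg hg0 hg1).eventually_hasDerivAt,
    (analyticAt_mul_exp_primF hf hg).eventually_hasDerivAt_integral] with x h1 h2 h3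
  have h4 := (h2.pow 2).unique ((h3.const_mul 2).congr_of_eventuallyEq h1)
  rw [← Real.exp_nat_mul]
  push_cast at h4 ⊢
  linear_combination h4 / 2

theorem deriv_bigX_pos {f g : ℝ → ℝ} (hf : AnalyticAt ℝ f 0) (hg : AnalyticAt ℝ g 0)
    (hg0 : g 0 = 0) (hg1 : deriv g 0 = 1) : ∀ᶠ x in 𝓝 0, 0 < deriv (bigX f g) x :=
  (analyticAt_bigX hf hg hg0 hg1).deriv.continuousAt.eventually
    (lt_mem_nhds (by simp [deriv_bigX_zero hf hg hg0 hg1]))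

/-- The local inverse of `x ↦ X(x)`. -/
theorem exists_bigX_inverse {f g : ℝ → ℝ} (hf : AnalyticAt ℝ f 0) (hg : AnalyticAt ℝ g 0)
    (hg0 : g 0 = 0) (hg1 : deriv g 0 = 1) :
    ∃ ξ : ℝ → ℝ, AnalyticAt ℝ ξ 0 ∧ ξ 0 = 0 ∧ (∀ᶠ z in 𝓝 0, bigX f g (ξ z) = z) ∧
      ∀ᶠ x in 𝓝 0, ξ (bigX f g x) = x := by
  have hX := analyticAt_bigX hf hg hg0 hg1
  have hX' : deriv (bigX f g) 0 ≠ 0 := by simp [deriv_bigX_zero hf hg hg0 hg1]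
  refine ⟨hX.hasStrictDerivAt.localInverse _ _ _ hX', ?_, ?_, ?_, ?_⟩
  · simpa using hX.analyticAt_localInverse hX'
  · simpa using (hX.hasStrictDerivAt.hasStrictFDerivAt_equiv hX').localInverse_apply_image
  · simpa using (hX.hasStrictDerivAt.hasStrictFDerivAt_equiv hX').eventually_right_inverse
  · exact (hX.hasStrictDerivAt.hasStrictFDerivAt_equiv hX').eventually_left_inverse

/-- There is an analytic `k` with `φ' = X' (1 + k(X))`. -/
theorem exists_analyticAt_urabe {f g : ℝ → ℝ} (hf : AnalyticAt ℝ f 0) (hg : AnalyticAt ℝ g 0)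
    (hg0 : g 0 = 0) (hg1 : deriv g 0 = 1) :
    ∃ k : ℝ → ℝ, AnalyticAt ℝ k 0 ∧
      ∀ᶠ x in 𝓝 0, Real.exp (primF f x) = deriv (bigX f g) x * (1 + k (bigX f g x)) := by
  obtain ⟨ξ, hξ, hξ0, h1, h2⟩ := exists_bigX_inverse hf hg hg0 hg1
  have hX := analyticAt_bigX hf hg hg0 hg1
  have hq : AnalyticAt ℝ (fun x => Real.exp (primF f x) / deriv (bigX f g) x) 0 :=
    (analyticAt_exp_primF hf).div hX.deriv (by simp [deriv_bigX_zero hf hg hg0 hg1])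
  refine ⟨fun z => Real.exp (primF f (ξ z)) / deriv (bigX f g) (ξ z) - 1, ?_, ?_⟩
  · exact (hq.comp_of_eq hξ hξ0).sub analyticAt_const
  · filter_upwards [h2, deriv_bigX_pos hf hg hg0 hg1] with x h3 h4
    rw [h3]
    field_simp
    ring

theorem tendsto_bigX {f g : ℝ → ℝ} (hf : AnalyticAt ℝ f 0) (hg : AnalyticAt ℝ g 0)
    (hg0 : g 0 = 0) (hg1 : deriv g 0 = 1) : Tendsto (bigX f g) (𝓝 0) (𝓝 0) := by
  simpa [ContinuousAt] using (analyticAt_bigX hf hg hg0 hg1).continuousAt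

/-- `X` is a local homeomorphism fixing `0`, so germs in `x` and germs in `X` carry the same
information. -/
theorem eventually_bigX_iff {f g : ℝ → ℝ} (hf : AnalyticAt ℝ f 0) (hg : AnalyticAt ℝ g 0)
    (hg0 : g 0 = 0) (hg1 : deriv g 0 = 1) {P : ℝ → Prop} :
    (∀ᶠ x in 𝓝 0, P (bigX f g x)) ↔ ∀ᶠ z in 𝓝 0, P z := by
  refine ⟨fun h => ?_, fun h => (tendsto_bigX hf hg hg0 hg1).eventually h⟩
  obtain ⟨ξ, hξ, hξ0, h1, -⟩ := exists_bigX_inverse hf hg hg0 hg1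
  have h2 : Tendsto ξ (𝓝 0) (𝓝 0) := by simpa [ContinuousAt, hξ0] using hξ.continuousAt
  filter_upwards [h1, h2.eventually h] with z h3 h4
  rwa [h3] at h4

theorem bigX_ne_zero {f g : ℝ → ℝ} (hf : AnalyticAt ℝ f 0) (hg : AnalyticAt ℝ g 0)
    (hg0 : g 0 = 0) (hg1 : deriv g 0 = 1) : ∀ᶠ x in 𝓝[≠] 0, bigX f g x ≠ 0 := by
  have h := (analyticAt_bigX hf hg hg0 hg1).differentiableAt.hasDerivAt.eventually_ne
    (c := 0) (by simp [deriv_bigX_zero hf hg hg0 hg1])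
  exact h

/-! ### Urabe functions and equation (*) -/

theorem ContDiffAt.eventually_hasDerivAt {h : ℝ → ℝ} {a : ℝ} (hh : ContDiffAt ℝ 1 h a) :
    ∀ᶠ z in 𝓝 a, HasDerivAt h (deriv h z) z :=
  (hh.eventually (by simp)).mono fun _ hz => (hz.differentiableAt one_ne_zero).hasDerivAt

/-- Multiplying the force identity by `e^F` and using `X X' = g e^{2F}` gives the right-hand
identity up to a factor vanishing only at `0`; continuity covers that point. -/
theorem force_eq_iff {f g : ℝ → ℝ} (hf : AnalyticAt ℝ f 0) (hg : AnalyticAt ℝ g 0)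
    (hg0 : g 0 = 0) (hg1 : deriv g 0 = 1) {h : ℝ → ℝ} (hh : ContinuousAt h 0)
    (hpos : ∀ᶠ z in 𝓝 (0 : ℝ), 0 < 1 + h z) :
    (∀ᶠ x in 𝓝 (0 : ℝ), g x * Real.exp (primF f x) = bigX f g x / (1 + h (bigX f g x))) ↔
      ∀ᶠ x in 𝓝 0, Real.exp (primF f x) = deriv (bigX f g) x * (1 + h (bigX f g x)) := by
  have hX := analyticAt_bigX hf hg hg0 hg1
  have hpos' := (tendsto_bigX hf hg hg0 hg1).eventually hpos
  constructor
  · intro H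
    have hc : ContinuousAt (fun x => deriv (bigX f g) x * (1 + h (bigX f g x))) 0 :=
      hX.deriv.continuousAt.mul
        (continuousAt_const.add (ContinuousAt.comp_of_eq hh hX.continuousAt (by simp)))
    refine ((analyticAt_exp_primF hf).continuousAt.eventuallyEq_nhds_iff_eventuallyEq_nhdsNE hc).1 ?_
    filter_upwards [H.filter_mono nhdsWithin_le_nhds, hpos'.filter_mono nhdsWithin_le_nhds,
      (bigX_mul_deriv_bigX hf hg hg0 hg1).filter_mono nhdsWithin_le_nhds,
      bigX_ne_zero hf hg hg0 hg1] with x h1 h2 h3 h4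
    have h5 : bigX f g x = g x * Real.exp (primF f x) * (1 + h (bigX f g x)) := by
      rw [h1, div_mul_cancel₀ _ h2.ne']
    have h6 : g x * Real.exp (primF f x) ≠ 0 := fun h7 => h4 (by rw [h5, h7, zero_mul])
    refine mul_left_cancel₀ h6 ?_
    linear_combination deriv (bigX f g) x * h5 - h3
  · intro H
    filter_upwards [H, hpos', bigX_mul_deriv_bigX hf hg hg0 hg1, deriv_bigX_pos hf hg hg0 hg1]
      with x h1 h2 h3 h4
    rw [eq_div_iff h2.ne']
    refine mul_right_cancel₀ h4.ne' ?_
    linear_combination -h3 - g x * Real.exp (primF f x) * h1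

/-- The force identity and the formula for `φ` both amount to `φ' = X' (1 + h(X))`, which at `0`
also yields `h 0 = 0` and hence positivity. -/
theorem isUrabeFunction_iff {f g : ℝ → ℝ} (hf : AnalyticAt ℝ f 0) (hg : AnalyticAt ℝ g 0)
    (hg0 : g 0 = 0) (hg1 : deriv g 0 = 1) {h : ℝ → ℝ} :
    IsUrabeFunction f g h ↔ ContDiffAt ℝ 1 h 0 ∧
      ∀ᶠ x in 𝓝 0, Real.exp (primF f x) = deriv (bigX f g) x * (1 + h (bigX f g x)) := by
  refine ⟨fun H => ⟨H.contDiffAt, (force_eq_iff hf hg hg0 hg1 H.contDiffAt.continuousAt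
    H.one_add_pos).1 H.force_eq⟩, fun ⟨hh, H⟩ => ?_⟩
  have h0 : h 0 = 0 := by
    have := H.self_of_nhds
    simpa [deriv_bigX_zero hf hg hg0 hg1] using this
  have hpos : ∀ᶠ z in 𝓝 (0 : ℝ), 0 < 1 + h z :=
    (continuousAt_const.add hh.continuousAt).eventually (lt_mem_nhds (by simp [h0]))
  refine ⟨hh, hpos, (force_eq_iff hf hg hg0 hg1 hh.continuousAt hpos).2 H, ?_⟩
  refine eventuallyEq_of_hasDerivAt (analyticAt_exp_primF hf).eventually_hasDerivAt_integral ?_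
    (by simp)
  have hi : ∀ᶠ z in 𝓝 0, HasDerivAt (fun z => ∫ t in (0 : ℝ)..z, h t) (h z) z :=
    eventually_hasDerivAt_integral (hh.eventually_hasDerivAt.mono fun _ hz => hz.continuousAt)
  filter_upwards [H, (analyticAt_bigX hf hg hg0 hg1).eventually_hasDerivAt,
    (tendsto_bigX hf hg hg0 hg1).eventually hi] with x h1 h2 h3
  rw [h1, mul_add, mul_one, mul_comm _ (h _)]
  exact h2.add (h3.comp x h2)

theorem IsUrabeFunction.apply_zero {f g : ℝ → ℝ} (hf : AnalyticAt ℝ f 0) (hg : AnalyticAt ℝ g 0)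
    (hg0 : g 0 = 0) (hg1 : deriv g 0 = 1) {h : ℝ → ℝ} (H : IsUrabeFunction f g h) : h 0 = 0 := by
  have := ((isUrabeFunction_iff hf hg hg0 hg1).1 H).2.self_of_nhds
  simpa [deriv_bigX_zero hf hg hg0 hg1] using this

theorem IsUrabeFunction.eventuallyEq {f g : ℝ → ℝ} (hf : AnalyticAt ℝ f 0)
    (hg : AnalyticAt ℝ g 0) (hg0 : g 0 = 0) (hg1 : deriv g 0 = 1) {h k : ℝ → ℝ}
    (hh : IsUrabeFunction f g h) (hk : IsUrabeFunction f g k) : h =ᶠ[𝓝 0] k := by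
  refine (eventually_bigX_iff hf hg hg0 hg1 (P := fun z => h z = k z)).1 ?_
  filter_upwards [((isUrabeFunction_iff hf hg hg0 hg1).1 hh).2,
    ((isUrabeFunction_iff hf hg hg0 hg1).1 hk).2, deriv_bigX_pos hf hg hg0 hg1] with x h1 h2 h3
  exact add_left_cancel (mul_left_cancel₀ h3.ne' (h1.symm.trans h2))

theorem hasDerivAt_mul_exp_primF {f g : ℝ → ℝ} (hf : AnalyticAt ℝ f 0) (hg : AnalyticAt ℝ g 0) :
    ∀ᶠ x in 𝓝 0, HasDerivAt (fun x => g x * Real.exp (primF f x))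
      ((deriv g x + f x * g x) * Real.exp (primF f x)) x := by
  filter_upwards [hg.eventually_hasDerivAt, hasDerivAt_primF hf] with x h1 h2
  convert! h1.mul h2.exp using 1
  ring

theorem hasDerivAt_bigX_div {f g : ℝ → ℝ} (hf : AnalyticAt ℝ f 0) (hg : AnalyticAt ℝ g 0)
    (hg0 : g 0 = 0) (hg1 : deriv g 0 = 1) {h : ℝ → ℝ} (hh : ContDiffAt ℝ 1 h 0)
    (hpos : ∀ᶠ z in 𝓝 (0 : ℝ), 0 < 1 + h z) :
    ∀ᶠ x in 𝓝 0, HasDerivAt (fun x => bigX f g x / (1 + h (bigX f g x)))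
      (deriv (bigX f g) x * (1 + h (bigX f g x) - deriv h (bigX f g x) * bigX f g x) /
        (1 + h (bigX f g x)) ^ 2) x := by
  have ht := tendsto_bigX hf hg hg0 hg1
  filter_upwards [ht.eventually hpos, (analyticAt_bigX hf hg hg0 hg1).eventually_hasDerivAt,
    ht.eventually hh.eventually_hasDerivAt] with x h1 h2 h3
  convert! h2.div ((h3.comp x h2).const_add 1) h1.ne' using 1
  simp only [Function.comp_apply]
  ring

theorem IsUrabeFunction.urabeEquation {f g : ℝ → ℝ} (hf : AnalyticAt ℝ f 0)
    (hg : AnalyticAt ℝ g 0) (hg0 : g 0 = 0) (hg1 : deriv g 0 = 1) {h : ℝ → ℝ}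
    (H : IsUrabeFunction f g h) : UrabeEquation f g h := by
  filter_upwards [((isUrabeFunction_iff hf hg hg0 hg1).1 H).2, H.force_eq.eventually_nhds,
    hasDerivAt_mul_exp_primF hf hg,
    hasDerivAt_bigX_div hf hg hg0 hg1 H.contDiffAt H.one_add_pos,
    (tendsto_bigX hf hg hg0 hg1).eventually H.one_add_pos, deriv_bigX_pos hf hg hg0 hg1]
    with x h1 h2 h3 h4 h5 h6
  have h7 := h3.unique (h4.congr_of_eventuallyEq h2)
  rw [h1, eq_div_iff (by positivity)] at h7
  rw [eq_div_iff (by positivity)]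
  refine mul_left_cancel₀ h6.ne' ?_
  linear_combination h7

/-- The factor `e^F` is not yet known in terms of `X'`, so (*) cannot be integrated directly.
Squaring the force introduces `g e^{2F} = X X'`, after which both sides have the same derivative; a
sign argument selects the root. -/
theorem UrabeEquation.isUrabeFunction {f g : ℝ → ℝ} (hf : AnalyticAt ℝ f 0)
    (hg : AnalyticAt ℝ g 0) (hg0 : g 0 = 0) (hg1 : deriv g 0 = 1) {h : ℝ → ℝ}
    (hh : ContDiffAt ℝ 1 h 0) (h0 : h 0 = 0) (H : UrabeEquation f g h) :
    IsUrabeFunction f g h := by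
  have hpos : ∀ᶠ z in 𝓝 (0 : ℝ), 0 < 1 + h z :=
    (continuousAt_const.add hh.continuousAt).eventually (lt_mem_nhds (by simp [h0]))
  have hpos' := (tendsto_bigX hf hg hg0 hg1).eventually hpos
  have hXX := bigX_mul_deriv_bigX hf hg hg0 hg1
  have hX' := deriv_bigX_pos hf hg hg0 hg1
  have hsq : (fun x => (g x * Real.exp (primF f x)) ^ 2) =ᶠ[𝓝 0]
      fun x => (bigX f g x / (1 + h (bigX f g x))) ^ 2 := by
    refine eventuallyEq_of_hasDerivAt
      ((hasDerivAt_mul_exp_primF hf hg).mono fun x hx => hx.pow 2) ?_ (by simp [hg0])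
    filter_upwards [H, hXX, hpos', hasDerivAt_bigX_div hf hg hg0 hg1 hh hpos]
      with x h1 h2 h3 h4
    convert! h4.pow 2 using 1
    rw [h1]
    push_cast
    field_simp
    linear_combination
      -(1 + h (bigX f g x) - deriv h (bigX f g x) * bigX f g x) * h2
  refine (isUrabeFunction_iff hf hg hg0 hg1).2
    ⟨hh, (force_eq_iff hf hg hg0 hg1 hh.continuousAt hpos).1 ?_⟩
  filter_upwards [hsq, hXX, hpos', hX'] with x h1 h2 h3 h4
  -- Both candidates have the sign of `X`, so their product is nonnegative; opposite values must
  -- then both vanish.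
  have h5 : 0 ≤ g x * Real.exp (primF f x) * (bigX f g x / (1 + h (bigX f g x))) := by
    have : g x * Real.exp (primF f x) * (bigX f g x / (1 + h (bigX f g x))) =
        bigX f g x ^ 2 * deriv (bigX f g) x / (Real.exp (primF f x) * (1 + h (bigX f g x))) := by
      field_simp
      linear_combination -bigX f g x * h2
    rw [this]
    have := Real.exp_pos (primF f x)
    positivity
  rcases sq_eq_sq_iff_eq_or_eq_neg.1 h1 with h6 | h6
  · exact h6
  · rw [h6] at h5 ⊢
    nlinarith

theorem exists_analyticAt_isUrabeFunction {f g : ℝ → ℝ} (hf : AnalyticAt ℝ f 0)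
    (hg : AnalyticAt ℝ g 0) (hg0 : g 0 = 0) (hg1 : deriv g 0 = 1) :
    ∃ k : ℝ → ℝ, AnalyticAt ℝ k 0 ∧ IsUrabeFunction f g k := by
  obtain ⟨k, hk, h⟩ := exists_analyticAt_urabe hf hg hg0 hg1
  exact ⟨k, hk, (isUrabeFunction_iff hf hg hg0 hg1).2 ⟨hk.contDiffAt, h⟩⟩

/-! ### Phase equation and periodic orbits -/

/-- The flow of the phase equation `θ' = 1 / a(θ)` for a positive `2π`-periodic function `a`: its
solutions advance by `2π` in the time `∫_0^{2π} a`. -/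
theorem exists_phase {a : ℝ → ℝ} {c : ℝ} (ha : Continuous a)
    (hper : Function.Periodic a (2 * Real.pi)) (hc : 0 < c) (hca : ∀ s, c ≤ a s) (θ₀ : ℝ) :
    ∃ θ : ℝ → ℝ, θ 0 = θ₀ ∧ StrictMono θ ∧ (∀ t, HasDerivAt θ (1 / a (θ t)) t) ∧
      ∀ t, θ (t + ∫ s in (0 : ℝ)..(2 * Real.pi), a s) = θ t + 2 * Real.pi := by
  set τ : ℝ → ℝ := fun x => ∫ s in θ₀..x, a s with hτ
  have hpos : ∀ s, 0 < a s := fun s => hc.trans_le (hca s)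
  have hd : ∀ x, HasDerivAt τ (a x) x := fun x => ha.integral_hasStrictDerivAt θ₀ x |>.hasDerivAt
  have hmono : StrictMono τ := strictMono_of_hasDerivAt_pos hd hpos
  have hcont : Continuous τ := continuous_iff_continuousAt.2 fun x => (hd x).continuousAt
  have hτ0 : τ θ₀ = 0 := by simp [hτ]
  -- The lower bound `c` makes the time function `τ` grow at least linearly in both directions,
  -- hence surjective; `θ` is its inverse.
  have hm : Monotone fun x => τ x - c * x := by
    refine monotone_of_hasDerivAt_nonneg
      (fun x => (hd x).sub ((hasDerivAt_id x).const_mul c)) fun x => ?_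
    simpa using hca x
  have hsurj : Function.Surjective τ := by
    refine hcont.surjective ?_ ?_
    · refine tendsto_atTop_mono' atTop (f₁ := fun x => c * x + -(c * θ₀)) ?_
        (tendsto_atTop_add_const_right _ _ (tendsto_id.const_mul_atTop hc))
      filter_upwards [eventually_ge_atTop θ₀] with x hx
      have := hm hx
      simp only [hτ0] at this
      linarith
    · refine tendsto_atBot_mono' atBot (f₁ := fun x => c * x + -(c * θ₀)) ?_
        (tendsto_atBot_add_const_right _ _ (tendsto_id.const_mul_atBot hc))
      filter_upwards [eventually_le_atBot θ₀] with x hx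
      have := hm hx
      simp only [hτ0] at this
      linarith
  set e : ℝ ≃o ℝ := hmono.orderIsoOfSurjective τ hsurj with he
  have heτ : ∀ t, τ (e.symm t) = t := fun t => e.apply_symm_apply t
  have hτe : ∀ x, e.symm (τ x) = x := fun x => e.symm_apply_apply x
  refine ⟨e.symm, by rw [← hτ0, hτe], e.symm.strictMono, fun t => ?_, fun t => ?_⟩
  · rw [one_div]
    exact HasDerivAt.of_local_left_inverse e.symm.continuous.continuousAt (hd _) (hpos _).ne'
      (Eventually.of_forall heτ)
  · have h1 : τ (e.symm t + 2 * Real.pi) = t + ∫ s in (0 : ℝ)..(2 * Real.pi), a s := by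
      have h2 := intervalIntegral.integral_add_adjacent_intervals
        (ha.intervalIntegrable (μ := MeasureTheory.volume) θ₀ (e.symm t))
        (ha.intervalIntegrable (e.symm t) (e.symm t + 2 * Real.pi))
      have h3 := hper.intervalIntegral_add_eq (e.symm t) 0
      rw [zero_add] at h3
      rw [← h3]
      exact h2.symm.trans (congrArg (· + _) (heτ t))
    rw [← h1, hτe]

/-- Near the value `z` the function `ξ` inverts `X` and the Urabe function `k` puts the equation
into its normal form. -/
structure IsChartAt (f g k ξ : ℝ → ℝ) (z : ℝ) : Prop where
  bigX_eq : bigX f g (ξ z) = z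
  hasDerivAt : HasDerivAt ξ ((1 + k z) / Real.exp (primF f (ξ z))) z
  hasDerivAt_primF : HasDerivAt (primF f) (f (ξ z)) (ξ z)
  half_le : 1 / 2 ≤ 1 + k z
  continuousAt : ContinuousAt k z
  force_eq : g (ξ z) * Real.exp (primF f (ξ z)) = z / (1 + k z)
  analyticAt_f : AnalyticAt ℝ f (ξ z)
  analyticAt_g : AnalyticAt ℝ g (ξ z)

theorem IsUrabeFunction.exists_isChartAt {f g : ℝ → ℝ} (hf : AnalyticAt ℝ f 0)
    (hg : AnalyticAt ℝ g 0) (hg0 : g 0 = 0) (hg1 : deriv g 0 = 1) {k : ℝ → ℝ}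
    (H : IsUrabeFunction f g k) :
    ∃ ξ : ℝ → ℝ, AnalyticAt ℝ ξ 0 ∧ ξ 0 = 0 ∧ (∀ᶠ x in 𝓝 0, ξ (bigX f g x) = x) ∧
      ∀ᶠ z in 𝓝 0, IsChartAt f g k ξ z := by
  obtain ⟨ξ, hξ, hξ0, h1, h2⟩ := exists_bigX_inverse hf hg hg0 hg1
  have ht : Tendsto ξ (𝓝 0) (𝓝 0) := by simpa [ContinuousAt, hξ0] using hξ.continuousAt
  have hk0 := H.apply_zero hf hg hg0 hg1
  have hX := analyticAt_bigX hf hg hg0 hg1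
  refine ⟨ξ, hξ, hξ0, h2, ?_⟩
  have hk2 : ∀ᶠ z in 𝓝 (0 : ℝ), 1 / 2 < 1 + k z :=
    (continuousAt_const.add H.contDiffAt.continuousAt).eventually
      (lt_mem_nhds (by norm_num [hk0]))
  filter_upwards [h1.eventually_nhds, hξ.eventually_hasDerivAt, ht.eventually (hasDerivAt_primF hf),
    hk2, H.contDiffAt.eventually_hasDerivAt, ht.eventually H.force_eq,
    ht.eventually hf.eventually_analyticAt, ht.eventually hg.eventually_analyticAt,
    ht.eventually hX.eventually_hasDerivAt,
    ht.eventually ((isUrabeFunction_iff hf hg hg0 hg1).1 H).2]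
    with z a1 a2 a3 a4 a5 a6 a7 a8 a9 a10
  have b1 := a1.self_of_nhds
  rw [b1] at a6 a10
  refine ⟨b1, ?_, a3, a4.le, a5.continuousAt, a6, a7, a8⟩
  have b2 := (a9.comp z a2).unique ((hasDerivAt_id z).congr_of_eventuallyEq a1)
  convert! a2 using 1
  rw [div_eq_iff (Real.exp_pos _).ne', a10]
  linear_combination -(1 + k z) * b2

theorem abs_mul_sin_lt {r δ : ℝ} (hr : 0 < r) (hrδ : r < δ) (s : ℝ) : |r * Real.sin s| < δ := by
  rw [abs_mul, abs_of_pos hr]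
  nlinarith [Real.abs_sin_le_one s]

theorem continuous_one_add_comp_sin {f g k ξ : ℝ → ℝ} {δ : ℝ}
    (hδ : ∀ z, |z| < δ → IsChartAt f g k ξ z) {r : ℝ} (hr : 0 < r)
    (hrδ : r < δ) : Continuous fun s => 1 + k (r * Real.sin s) := by
  refine continuous_const.add (continuous_iff_continuousAt.2 fun s => ?_)
  exact ContinuousAt.comp' (f := fun s => r * Real.sin s)
    (hδ _ (abs_mul_sin_lt hr hrδ s)).continuousAt (by fun_prop)

/-- The orbits in polar coordinates. -/
theorem exists_orbit {f g k ξ : ℝ → ℝ} {δ : ℝ}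
    (hδ : ∀ z, |z| < δ → IsChartAt f g k ξ z) {r : ℝ} (hr : 0 < r) (hrδ : r < δ)
    (θ₀ : ℝ) :
    ∃ θ : ℝ → ℝ, θ 0 = θ₀ ∧
      IsSolution f g (fun t => ξ (r * Real.sin (θ t)))
        (fun t => r * Real.cos (θ t) / Real.exp (primF f (ξ (r * Real.sin (θ t))))) ∧
      IsMinimalPeriod (fun t => (ξ (r * Real.sin (θ t)),
        r * Real.cos (θ t) / Real.exp (primF f (ξ (r * Real.sin (θ t))))))
        (∫ s in (0 : ℝ)..(2 * Real.pi), (1 + k (r * Real.sin s))) := by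
  have hz := abs_mul_sin_lt hr hrδ
  have hcont := continuous_one_add_comp_sin hδ hr hrδ
  obtain ⟨θ, h0, hmono, hd, hper⟩ := exists_phase hcont
    (fun s => by simp) (by norm_num : (0 : ℝ) < 1 / 2) (fun s => (hδ _ (hz s)).half_le) θ₀
  have hpos : ∀ s, 0 < 1 + k (r * Real.sin s) := fun s =>
    lt_of_lt_of_le (by norm_num) (hδ _ (hz s)).half_le
  refine ⟨θ, h0, fun t => ?_, ⟨?_, fun t => ?_⟩, fun S hS => ?_⟩
  · have hch := hδ _ (hz (θ t))
    have hp := hpos (θ t)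
    have hE := Real.exp_pos (primF f (ξ (r * Real.sin (θ t))))
    have hX : HasDerivAt (fun t => r * Real.sin (θ t))
        (r * (Real.cos (θ t) * (1 / (1 + k (r * Real.sin (θ t)))))) t :=
      ((hd t).sin).const_mul r
    have hx : HasDerivAt (fun t => ξ (r * Real.sin (θ t)))
        (r * Real.cos (θ t) / Real.exp (primF f (ξ (r * Real.sin (θ t))))) t := by
      convert! hch.hasDerivAt.comp t hX using 1
      field_simp
    refine ⟨hx, ?_⟩
    convert! (((hd t).cos).const_mul r).div
      ((hch.hasDerivAt_primF.comp t hx).exp) (Real.exp_pos _).ne' using 1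
    have hF := hch.force_eq
    rw [eq_div_iff hp.ne'] at hF
    simp only [Function.comp_apply]
    field_simp
    linear_combination -Real.exp (primF f (ξ (r * Real.sin (θ t)))) * hF
  · exact intervalIntegral.intervalIntegral_pos_of_pos (hcont.intervalIntegrable _ _) hpos
      (by positivity)
  · simp [hper t]
  -- Returning to the initial point means equal sine and cosine of the phase, so `θ` has advanced by
  -- a positive multiple of `2π`, hence by at least one full turn.
  · obtain ⟨hS0, hS⟩ := hS
    have h1 := hS 0
    simp only [zero_add, Prod.mk.injEq] at h1
    obtain ⟨h2, h3⟩ := h1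
    rw [h2, div_left_inj' (Real.exp_pos _).ne'] at h3
    have h4 := congrArg (bigX f g) h2
    rw [(hδ _ (hz _)).bigX_eq, (hδ _ (hz _)).bigX_eq] at h4
    obtain ⟨n, hn⟩ := Real.Angle.angle_eq_iff_two_pi_dvd_sub.1
      (Real.Angle.cos_sin_inj (mul_left_cancel₀ hr.ne' h3) (mul_left_cancel₀ hr.ne' h4))
    have h5 : 0 < 2 * Real.pi * n := by
      rw [← hn]
      exact sub_pos.2 (hmono hS0)
    have h6 : (1 : ℝ) ≤ n := by
      have : (0 : ℝ) < n := pos_of_mul_pos_right h5 (by positivity)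
      exact_mod_cast this
    refine hmono.le_iff_le.1 ?_
    have h7 := hper 0
    rw [zero_add] at h7
    rw [h7]
    nlinarith [Real.pi_pos]

/-! ### The period integral and constancy of the even part -/

/-- Shifting the second half-turn by `π` flips the sign of the sine, so only the even part of `k`
survives. -/
theorem integral_one_add_comp_sin {k : ℝ → ℝ} {r : ℝ}
    (hk : Continuous fun s => 1 + k (r * Real.sin s)) :
    (∫ s in (0 : ℝ)..(2 * Real.pi), (1 + k (r * Real.sin s))) =
      ∫ s in (0 : ℝ)..Real.pi, (2 + (k (r * Real.sin s) + k (-(r * Real.sin s)))) := by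
  have hk' : Continuous fun s => 1 + k (r * Real.sin (s + Real.pi)) :=
    hk.comp (continuous_add_const Real.pi)
  rw [← intervalIntegral.integral_add_adjacent_intervals (hk.intervalIntegrable 0 Real.pi)
    (hk.intervalIntegrable _ _)]
  have h := intervalIntegral.integral_comp_add_right (a := 0) (b := Real.pi)
    (fun s => 1 + k (r * Real.sin s)) Real.pi
  rw [zero_add, ← two_mul] at h
  rw [← h, ← intervalIntegral.integral_add (hk.intervalIntegrable _ _)
    (hk'.intervalIntegrable _ _)]
  refine intervalIntegral.integral_congr fun s _ => ?_
  simp only [Real.sin_add_pi, mul_neg]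
  ring

/-- An analytic function whose mean values along `s ↦ r sin s`, `0 ≤ s ≤ π`, do not depend on the
small number `r > 0` is constant near `0`. -/
theorem AnalyticAt.eventually_eq_of_integral_comp_sin {u : ℝ → ℝ} {c : ℝ} (hu : AnalyticAt ℝ u 0)
    (h : ∀ᶠ r in 𝓝[>] 0, ∫ s in (0 : ℝ)..Real.pi, u (r * Real.sin s) = c) :
    ∀ᶠ z in 𝓝 0, u z = c / Real.pi := by
  have hv : AnalyticAt ℝ (fun z => u z - c / Real.pi) 0 := hu.sub analyticAt_const
  -- Zeros of a nonzero analytic germ are isolated. If `u` were not constant, `u(r sin s) - c / π`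
  -- would have no zero on `(0, π)`, hence one sign there, contradicting its zero integral.
  rcases hv.eventually_eq_zero_or_eventually_ne_zero with h0 | h0
  · exact h0.mono fun z hz => sub_eq_zero.1 hz
  exfalso
  obtain ⟨ε, hε, hb⟩ := Metric.eventually_nhds_iff_ball.1
    ((eventually_nhdsWithin_iff.1 h0).and hu.eventually_analyticAt)
  obtain ⟨r, hr, hrε : r < ε, hr0 : 0 < r⟩ := (h.and
    ((eventually_nhdsWithin_of_eventually_nhds (eventually_lt_nhds hε)).and
      self_mem_nhdsWithin)).exists
  have hz : ∀ s, r * Real.sin s ∈ Metric.ball (0 : ℝ) ε := fun s => by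
    simpa using abs_mul_sin_lt hr0 hrε s
  have hcu : Continuous fun s => u (r * Real.sin s) := continuous_iff_continuousAt.2 fun s =>
    ContinuousAt.comp' (f := fun s => r * Real.sin s) (hb _ (hz s)).2.continuousAt (by fun_prop)
  set w : ℝ → ℝ := fun s => u (r * Real.sin s) - c / Real.pi with hw
  have hcw : Continuous w := hcu.sub continuous_const
  have hint : ∫ s in (0 : ℝ)..Real.pi, w s = 0 := by
    rw [hw, intervalIntegral.integral_sub (hcu.intervalIntegrable _ _) (by simp), hr]
    simp only [intervalIntegral.integral_const, smul_eq_mul]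
    field_simp
    ring
  have hne : ∀ s ∈ Set.Ioo 0 Real.pi, w s ≠ 0 := fun s hs =>
    (hb _ (hz s)).1 (mul_pos hr0 (Real.sin_pos_of_mem_Ioo hs)).ne'
  have hsign : (∀ s ∈ Set.Ioo 0 Real.pi, 0 < w s) ∨ ∀ s ∈ Set.Ioo 0 Real.pi, 0 < -w s := by
    by_contra! hcon
    obtain ⟨⟨s, hs, hs'⟩, t, ht, ht'⟩ := hcon
    obtain ⟨q, hq, hq'⟩ := isPreconnected_Ioo.intermediate_value hs ht hcw.continuousOn
      ⟨hs', neg_nonpos.1 ht'⟩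
    exact hne q hq hq'
  rcases hsign with hp | hp
  · exact (intervalIntegral.intervalIntegral_pos_of_pos_on (hcw.intervalIntegrable _ _) hp
      Real.pi_pos).ne' hint
  · refine (intervalIntegral.intervalIntegral_pos_of_pos_on (hcw.neg.intervalIntegrable _ _) hp
      Real.pi_pos).ne' ?_
    simp [hint]

/-! ### Uniqueness of solutions -/

/-- A solution along which `f` and `g` are analytic is the only one with its initial value. -/
theorem IsSolution.eq_of_apply_zero_eq {f g x y x' y' : ℝ → ℝ}
    (hf : ∀ t, AnalyticAt ℝ f (x t)) (hg : ∀ t, AnalyticAt ℝ g (x t)) (h : IsSolution f g x y)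
    (h' : IsSolution f g x' y') (h0 : (x 0, y 0) = (x' 0, y' 0)) :
    (fun t => (x t, y t)) = fun t => (x' t, y' t) := by
  set v : ℝ × ℝ → ℝ × ℝ := fun p => (p.2, -g p.1 - f p.1 * p.2 ^ 2) with hv
  have hd : ∀ t, HasDerivAt (fun t => (x t, y t)) (v (x t, y t)) t := fun t =>
    (h t).1.prodMk (h t).2
  have hd' : ∀ t, HasDerivAt (fun t => (x' t, y' t)) (v (x' t, y' t)) t := fun t =>
    (h' t).1.prodMk (h' t).2
  have hc : Continuous fun t => (x t, y t) := continuous_iff_continuousAt.2 fun t =>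
    (hd t).continuousAt
  have hc' : Continuous fun t => (x' t, y' t) := continuous_iff_continuousAt.2 fun t =>
    (hd' t).continuousAt
  -- Closedness is continuity and openness is local Lipschitz uniqueness; connectedness of the time
  -- line then gives global agreement.
  have hcl : IsClopen {t | (x t, y t) = (x' t, y' t)} := by
    refine ⟨isClosed_eq hc hc', isOpen_iff_mem_nhds.2 fun t (ht : (x t, y t) = (x' t, y' t)) => ?_⟩
    have hvC : ContDiffAt ℝ 1 v (x t, y t) := by
      have hfC : ContDiffAt ℝ 1 (fun p : ℝ × ℝ => f p.1) (x t, y t) :=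
        ContDiffAt.comp (x t, y t) (hf t).contDiffAt contDiffAt_fst
      have hgC : ContDiffAt ℝ 1 (fun p : ℝ × ℝ => g p.1) (x t, y t) :=
        ContDiffAt.comp (x t, y t) (hg t).contDiffAt contDiffAt_fst
      exact contDiffAt_snd.prodMk (hgC.neg.sub (hfC.mul (contDiffAt_snd.pow 2)))
    obtain ⟨K, s, hs, hL⟩ := hvC.exists_lipschitzOnWith
    refine ODE_solution_unique_of_eventually (v := fun _ => v) (s := fun _ => s) (K := K)
      (Eventually.of_forall fun _ => hL) ?_ ?_ ht
    · filter_upwards [hc.continuousAt.eventually hs] with q hq using ⟨hd q, hq⟩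
    · rw [ht] at hs
      filter_upwards [hc'.continuousAt.eventually hs] with q hq using ⟨hd' q, hq⟩
  have huniv := hcl.eq_univ ⟨0, h0⟩
  funext t
  have : t ∈ {t | (x t, y t) = (x' t, y' t)} := by rw [huniv]; trivial
  exact this

theorem exists_polar (z w : ℝ) :
    ∃ r θ : ℝ, 0 ≤ r ∧ r ^ 2 = z ^ 2 + w ^ 2 ∧ r * Real.sin θ = z ∧ r * Real.cos θ = w := by
  refine ⟨‖(⟨w, z⟩ : ℂ)‖, Complex.arg ⟨w, z⟩, norm_nonneg _, ?_, Complex.norm_mul_sin_arg _,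
    Complex.norm_mul_cos_arg _⟩
  rw [Complex.sq_norm, Complex.normSq_apply]
  ring

/-! ### Isochronicity and the main theorem -/

theorem IsIsochronousCenter.exists_isUrabeFunction {f g : ℝ → ℝ} (hf : AnalyticAt ℝ f 0)
    (hg : AnalyticAt ℝ g 0) (hg0 : g 0 = 0) (hg1 : deriv g 0 = 1) (H : IsIsochronousCenter f g) :
    ∃ h : ℝ → ℝ, IsOddC1 h ∧ IsUrabeFunction f g h := by
  obtain ⟨-, T, U, hU, hT⟩ := H
  obtain ⟨k, hk, hkU⟩ := exists_analyticAt_isUrabeFunction hf hg hg0 hg1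
  obtain ⟨ξ, -, hξ0, -, hch⟩ := hkU.exists_isChartAt hf hg hg0 hg1
  obtain ⟨δ, hδ0, hδ⟩ := Metric.eventually_nhds_iff.1 hch
  replace hδ : ∀ z, |z| < δ → IsChartAt f g k ξ z := fun z hz => hδ (by simpa using hz)
  refine ⟨k, ⟨hk.contDiffAt, ?_⟩, hkU⟩
  have hUr : ∀ᶠ r : ℝ in 𝓝[>] 0, ((0 : ℝ), r) ∈ U :=
    eventually_nhdsWithin_of_eventually_nhds
      ((show Continuous fun r : ℝ => ((0 : ℝ), r) by fun_prop).tendsto 0 hU)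
  have hneg : AnalyticAt ℝ (fun z => k (-z)) 0 :=
    AnalyticAt.comp_of_eq hk (analyticAt_id.neg) (by simp)
  have hu : AnalyticAt ℝ (fun z => 2 + (k z + k (-z))) 0 := analyticAt_const.add (hk.add hneg)
  have hconst : ∀ᶠ z in 𝓝 0, 2 + (k z + k (-z)) = T / Real.pi := by
    refine hu.eventually_eq_of_integral_comp_sin ?_
    filter_upwards [hUr, eventually_nhdsWithin_of_eventually_nhds (eventually_lt_nhds hδ0),
      self_mem_nhdsWithin] with r hrU hrδ hr
    -- Phase `0` starts at the point `(0, r)`. Uniqueness identifies this orbit with the one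
    -- supplied by the center, so its period integral equals `T`.
    obtain ⟨θ, hθ0, hsol, hmin⟩ := exists_orbit hδ hr hrδ 0
    obtain ⟨x, y, hsol', h0, -, hmin'⟩ := hT _ hrU (by simpa using (show r ≠ 0 from ne_of_gt hr))
    have heq := hsol.eq_of_apply_zero_eq
      (fun t => (hδ _ (abs_mul_sin_lt hr hrδ _)).analyticAt_f)
      (fun t => (hδ _ (abs_mul_sin_lt hr hrδ _)).analyticAt_g) hsol'
      (by rw [h0]; simp [hθ0, hξ0])
    rw [← integral_one_add_comp_sin (continuous_one_add_comp_sin hδ hr hrδ)]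
    rw [heq] at hmin
    exact hmin.unique hmin'
  have hk0 := hkU.apply_zero hf hg hg0 hg1
  have h2 := hconst.self_of_nhds
  rw [neg_zero, hk0] at h2
  filter_upwards [hconst] with z hz
  linarith

theorem IsUrabeFunction.isIsochronousCenter {f g : ℝ → ℝ} (hf : AnalyticAt ℝ f 0)
    (hg : AnalyticAt ℝ g 0) (hg0 : g 0 = 0) (hg1 : deriv g 0 = 1) {h : ℝ → ℝ}
    (H : IsUrabeFunction f g h) (hodd : ∀ᶠ z in 𝓝 (0 : ℝ), h (-z) = -h z) :
    IsIsochronousCenter f g := by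
  obtain ⟨ξ, hξ, hξ0, hξX, hch⟩ := H.exists_isChartAt hf hg hg0 hg1
  obtain ⟨δ, hδ0, hδ'⟩ := Metric.eventually_nhds_iff.1 (hch.and hodd)
  have hδ : ∀ z, |z| < δ → IsChartAt f g h ξ z := fun z hz => (hδ' (by simpa using hz)).1
  set Ψ : ℝ × ℝ → ℝ × ℝ := fun q => (ξ q.1, q.2 / Real.exp (primF f (ξ q.1))) with hΨ
  -- The neighborhood is a disk in the coordinates `(X, e^F y)`; orbits are circles there, so it is
  -- invariant.
  refine ⟨hg0, 2 * Real.pi, Ψ '' {q | q.1 ^ 2 + q.2 ^ 2 < δ ^ 2}, ?_, ?_⟩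
  · have hc : ContinuousAt
        (fun p : ℝ × ℝ => bigX f g p.1 ^ 2 + (p.2 * Real.exp (primF f p.1)) ^ 2) 0 := by
      have h1 : ContinuousAt (fun p : ℝ × ℝ => bigX f g p.1) 0 :=
        ContinuousAt.comp' (f := Prod.fst) (x := (0 : ℝ × ℝ))
          (analyticAt_bigX hf hg hg0 hg1).continuousAt continuousAt_fst
      have h2 : ContinuousAt (fun p : ℝ × ℝ => Real.exp (primF f p.1)) 0 :=
        ContinuousAt.comp' (f := Prod.fst) (x := (0 : ℝ × ℝ))
          (analyticAt_exp_primF hf).continuousAt continuousAt_fst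
      exact (h1.pow 2).add ((continuousAt_snd.mul h2).pow 2)
    have hfst : Tendsto (Prod.fst : ℝ × ℝ → ℝ) (𝓝 0) (𝓝 0) := continuous_fst.tendsto 0
    filter_upwards [Filter.Tendsto.eventually_lt_const (u := δ ^ 2) (by simpa using pow_pos hδ0 2) hc,
      hfst.eventually hξX] with p h1 h2
    refine ⟨(bigX f g p.1, p.2 * Real.exp (primF f p.1)), h1, ?_⟩
    simp [hΨ, h2]
  · rintro _ ⟨⟨z, w⟩, hzw, rfl⟩ hne
    obtain ⟨r, θ₀, hr0, hr, rfl, rfl⟩ := exists_polar z w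
    have hrδ : r < δ := by
      refine lt_of_pow_lt_pow_left₀ 2 hδ0.le ?_
      rw [hr]
      exact hzw
    have hrpos : 0 < r := by
      refine hr0.lt_of_ne fun h0 => hne ?_
      simp [hΨ, ← h0, hξ0]
    obtain ⟨θ, hθ0, hsol, hmin⟩ := exists_orbit hδ hrpos hrδ θ₀
    refine ⟨_, _, hsol, by simp [hΨ, hθ0], fun t => ?_, ?_⟩
    · refine ⟨(r * Real.sin (θ t), r * Real.cos (θ t)), ?_, rfl⟩
      have := Real.sin_sq_add_cos_sq (θ t)
      have h2 : (r * Real.sin (θ t)) ^ 2 + (r * Real.cos (θ t)) ^ 2 = r ^ 2 := by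
        linear_combination r ^ 2 * this
      exact h2.trans_lt (pow_lt_pow_left₀ hrδ hr0 two_ne_zero)
    · convert! hmin using 1
      rw [integral_one_add_comp_sin (continuous_one_add_comp_sin hδ hrpos hrδ)]
      rw [intervalIntegral.integral_congr (g := fun _ => (2 : ℝ)) fun s _ => ?_]
      · simp [mul_comm]
      · simp [(hδ' (by simpa using abs_mul_sin_lt hrpos hrδ s) :
          IsChartAt f g h ξ (r * Real.sin s) ∧ _).2]

theorem mainTheorem8 (f g : ℝ → ℝ) (hf : AnalyticAt ℝ f 0) (hg : AnalyticAt ℝ g 0)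
    (hg0 : g 0 = 0) (hg1 : deriv g 0 = 1) :
    (IsIsochronousCenter f g ↔
      ∃ h : ℝ → ℝ, IsOddC1 h ∧ IsUrabeFunction f g h ∧ UrabeEquation f g h) ∧
    (∀ h : ℝ → ℝ, IsOddC1 h → UrabeEquation f g h → IsUrabeFunction f g h) ∧
    ((∀ᶠ x in 𝓝 (0 : ℝ), f (-x) = -f x) → (∀ᶠ x in 𝓝 (0 : ℝ), g (-x) = -g x) →
      ∀ h : ℝ → ℝ, IsUrabeFunction f g h →
        ((∀ᶠ x in 𝓝 (0 : ℝ), deriv g x + f x * g x = 1) ↔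
          ∀ᶠ X in 𝓝 (0 : ℝ), h X = 0)) := by
  refine ⟨⟨fun H => ?_, fun ⟨h, hodd, hU, _⟩ => ?_⟩, fun h hodd hE => ?_, fun _ _ h hU =>
    ⟨fun h1 => ?_, fun h0 => ?_⟩⟩
  · obtain ⟨h, hodd, hU⟩ := H.exists_isUrabeFunction hf hg hg0 hg1
    exact ⟨h, hodd, hU, hU.urabeEquation hf hg hg0 hg1⟩
  · exact hU.isIsochronousCenter hf hg hg0 hg1 hodd.2
  · refine hE.isUrabeFunction hf hg hg0 hg1 hodd.1 ?_
    have := hodd.2.self_of_nhds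
    rw [neg_zero] at this
    linarith
  -- With left side `1`, (*) is solved by the zero function, which is thus a Urabe function;
  -- uniqueness of the germ gives `h = 0`.
  · have hE : UrabeEquation f g fun _ => 0 := h1.mono fun x hx => by simpa using hx
    exact hU.eventuallyEq hf hg hg0 hg1
      (hE.isUrabeFunction hf hg hg0 hg1 contDiffAt_const rfl)
  · have ht := tendsto_bigX hf hg hg0 hg1
    filter_upwards [hU.urabeEquation hf hg hg0 hg1, ht.eventually (eventually_eventually_nhds.2 h0)]
      with x h1 h2
    rw [h1, h2.self_of_nhds, (show h =ᶠ[𝓝 _] fun _ => 0 from h2).deriv_eq]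
    simp
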